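/- Let $n\ge 0$, let $\mathfrak u(n)$ be the real Lie algebra of skew-Hermitian complex $n\times n$ matrices, with Killing form $B(X,Y)=\operatorname{tr}(\operatorname{ad}X\circ\operatorname{ad}Y)$, and let $U(n)$ act on $\mathfrak u(n)$ by $\mathrm{Ad}(g)X=gXg^{-1}$. Let $h\in\mathfrak u(n)$, and let $H(\lambda)=\{\,\mathrm{Ad}(g)h : g\in U(n)\,\}$ be its adjoint orbit, $\lambda$ denoting the eigenvalues of $h$ with multiplicity. Then $H(\lambda)$, with the subspace topology, has the structure of a smooth manifold for which the inclusion into $\mathfrak u(n)$ is a smooth embedding; its tangent space at $x\in H(\lambda)$, viewed in $\mathfrak u(n)$, is $T_xH(\lambda)=\{[x,X] : X\in\mathfrak u(n)\}$; and there is exactly one field $\Omega=(\Omega_x)_{x\in H(\lambda)}$ of alternating bilinear forms $\Omega_x$ on $T_xH(\lambda)$ such that $$\Omega_x([x,X],[x,Y]) = B(x,[X,Y])\qquad\text{for all } x\in H(\lambda),\ X,Y\in\mathfrak u(n).$$ This $\Omega$ is smooth, closed ($d\Omega=0$) and nondegenerate, and it is invariant under $U(n)$: every $g\in U(n)$ acts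 on $H(\lambda)$ by a smooth map $\ell_g(x)=\mathrm{Ad}(g)x$ with $\ell_g^*\Omega=\Omega$. In particular every adjoint orbit of $U(n)$ is a symplectic manifold. -/

import Mathlib

open scoped Matrix Manifold ContDiff

noncomputable section

namespace UnitaryOrbit

attribute [local instance] LieRing.ofAssociativeRing

/-- The Lie algebra `𝔲(n)` of skew-Hermitian `n × n` complex matrices, a real Lie algebra under the
commutator bracket. -/
def u (n : ℕ) : LieSubalgebra ℝ (Matrix (Fin n) (Fin n) ℂ) where
  carrier := {A | A + Aᴴ = 0}
  zero_mem' := by simp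
  add_mem' := by
    intro A B hA hB
    have hA' : Aᴴ = -A := (neg_eq_of_add_eq_zero_right hA).symm
    have hB' : Bᴴ = -B := (neg_eq_of_add_eq_zero_right hB).symm
    simp only [Set.mem_ofPred_eq, Matrix.conjTranspose_add, hA', hB']
    abel
  smul_mem' := by
    intro c A hA
    have hA' : Aᴴ = -A := (neg_eq_of_add_eq_zero_right hA).symm
    simp [Matrix.conjTranspose_smul, hA']
  lie_mem' := by
    intro A B hA hB
    have hA' : Aᴴ = -A := (neg_eq_of_add_eq_zero_right hA).symm
    have hB' : Bᴴ = -B := (neg_eq_of_add_eq_zero_right hB).symm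
    simp [Ring.lie_def, Matrix.conjTranspose_sub, Matrix.conjTranspose_mul, hA', hB']

section Norm

-- The choice of the norm is immaterial: all norms on `𝔲(n)` give the same topology and the same
-- smooth maps.
attribute [local instance] Matrix.normedAddCommGroup Matrix.normedSpace

instance instNormedAddCommGroup (n : ℕ) : NormedAddCommGroup (u n) :=
  NormedAddCommGroup.induced (u n) (Matrix (Fin n) (Fin n) ℂ)
    (LinearMap.toAddMonoidHom (u n).toSubmodule.subtype) Subtype.val_injective

instance instNormedSpace (n : ℕ) : NormedSpace ℝ (u n) :=
  NormedSpace.induced ℝ (u n) (Matrix (Fin n) (Fin n) ℂ) (u n).toSubmodule.subtype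

end Norm

-- Shortcut instances: the topology and uniformity of `𝔲(n)` are found through the norm. They agree
-- with the ones induced from the space of matrices.
instance instUniformSpace (n : ℕ) : UniformSpace (u n) :=
  (instNormedAddCommGroup n).toPseudoMetricSpace.toUniformSpace

instance instTopologicalSpace (n : ℕ) : TopologicalSpace (u n) :=
  (instUniformSpace n).toTopologicalSpace

lemma topology_eq_induced (n : ℕ) : instTopologicalSpace n =
    TopologicalSpace.induced Subtype.val
      (inferInstance : TopologicalSpace (Matrix (Fin n) (Fin n) ℂ)) :=
  rfl

/-- The adjoint action `Ad(g) X = g X g⁻¹` of `U(n)` on `𝔲(n)`. -/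
def Ad {n : ℕ} (g : Matrix.unitaryGroup (Fin n) ℂ) (X : u n) : u n :=
  ⟨(g : Matrix (Fin n) (Fin n) ℂ) * X * (g⁻¹ : Matrix.unitaryGroup (Fin n) ℂ), by
    have hX : (X : Matrix (Fin n) (Fin n) ℂ)ᴴ = -X := (neg_eq_of_add_eq_zero_right X.2).symm
    change _ + _ = _
    simp [← Matrix.star_eq_conjTranspose, mul_assoc]
    simp [Matrix.star_eq_conjTranspose, hX]⟩

/-- The adjoint orbit `{Ad(g) h : g ∈ U(n)}` of `h`. -/
def adjointOrbit {n : ℕ} (h : u n) : Set (u n) :=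
  {Y | ∃ g : Matrix.unitaryGroup (Fin n) ℂ, Y = Ad g h}

lemma Ad_mem_adjointOrbit {n : ℕ} {h : u n} (g : Matrix.unitaryGroup (Fin n) ℂ)
    (x : adjointOrbit h) : Ad g x ∈ adjointOrbit h := by
  obtain ⟨_, k, rfl⟩ := x
  refine ⟨g * k, Subtype.ext ?_⟩
  simp [Ad, mul_assoc]

/-- The action of `U(n)` on an adjoint orbit. -/
def orbitAct {n : ℕ} {h : u n} (g : Matrix.unitaryGroup (Fin n) ℂ) (x : adjointOrbit h) :
    adjointOrbit h :=
  ⟨Ad g x, Ad_mem_adjointOrbit g x⟩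

section Forms

variable {E : Type*} [NormedAddCommGroup E] [NormedSpace ℝ E]
  {M : Type*} [TopologicalSpace M] [ChartedSpace E M]

variable (E M) in
/-- A (not necessarily smooth) field of alternating `2`-forms on the tangent spaces of a manifold
`M` without boundary, modelled on `E`. -/
abbrev TwoFormField : Type _ := ∀ x : M, TangentSpace 𝓘(ℝ, E) x [⋀^Fin 2]→L[ℝ] ℝ

/-- The expression of a field of `2`-forms in a chart `e`, that is, its pullback under the
parametrization `e.symm : e.target → M`. -/
def TwoFormField.inChart (Ω : TwoFormField E M) (e : OpenPartialHomeomorph M E) (y : E) :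
    E [⋀^Fin 2]→L[ℝ] ℝ :=
  (Ω (e.symm y)).compContinuousLinearMap (mfderiv 𝓘(ℝ, E) 𝓘(ℝ, E) e.symm y)

/-- A symplectic form: a smooth, closed and nondegenerate `2`-form. -/
structure IsSymplectic (Ω : TwoFormField E M) : Prop where
  smooth : ∀ e ∈ atlas E M, ContDiffOn ℝ ∞ (Ω.inChart e) e.target
  closed : ∀ e ∈ atlas E M, ∀ y ∈ e.target, extDeriv (Ω.inChart e) y = 0
  nondegenerate : ∀ (x : M) (v : TangentSpace 𝓘(ℝ, E) x),
    (∀ w : TangentSpace 𝓘(ℝ, E) x, Ω x ![v, w] = 0) → v = 0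

end Forms

section Orbit

variable {n : ℕ} {h : u n} {E : Type*} [NormedAddCommGroup E] [NormedSpace ℝ E]
  [ChartedSpace E (adjointOrbit h)]

variable (E) in
/-- The differential at `x` of the inclusion of the orbit into `𝔲(n)`; it identifies tangent vectors
of the orbit with elements of `𝔲(n)`. -/
def inclDeriv (x : adjointOrbit h) : TangentSpace 𝓘(ℝ, E) x →L[ℝ] u n :=
  mfderiv 𝓘(ℝ, E) 𝓘(ℝ, u n) (Subtype.val : adjointOrbit h → u n) x

/-- `Ω_x([x, X], [x, Y]) = B(x, [X, Y])` at every point `x` of the orbit and for all `X, Y ∈ 𝔲(n)`,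
where `B` is the Killing form of `𝔲(n)`. -/
def IsOrbitForm (Ω : TwoFormField E (adjointOrbit h)) : Prop :=
  ∀ (x : adjointOrbit h) (X Y : u n) (v w : TangentSpace 𝓘(ℝ, E) x),
    inclDeriv E x v = ⁅(x : u n), X⁆ → inclDeriv E x w = ⁅(x : u n), Y⁆ →
      Ω x ![v, w] = killingForm ℝ (u n) x ⁅X, Y⁆

/-- `Ω` is invariant under the action of `U(n)`: each `g` acts smoothly on the orbit and pulls
`Ω` back to itself. -/
def IsInvariant (Ω : TwoFormField E (adjointOrbit h)) : Prop :=
  ∀ g : Matrix.unitaryGroup (Fin n) ℂ,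
    ContMDiff 𝓘(ℝ, E) 𝓘(ℝ, E) ∞ (orbitAct g : adjointOrbit h → adjointOrbit h) ∧
    ∀ x : adjointOrbit h,
      (Ω (orbitAct g x)).compContinuousLinearMap
        (mfderiv 𝓘(ℝ, E) 𝓘(ℝ, E) (orbitAct g) x) = Ω x

end Orbit

end UnitaryOrbit

end

/-! For the inner product `Re tr(Xᴴ Y)` every `ad x` is skew, so `𝔲(n)` splits as `range (ad h) ⊕
ker (ad h)`: tangent plus normal space of the orbit at `h`. The map `(v, Z) ↦ Ad(exp v)(h + Z)`,
with `v` tangent and `Z` normal, has at `0` the invertible derivative `(v, Z) ↦ [v, h] + Z`, so it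
is a local diffeomorphism. Its value lies in the orbit iff `h + Z` does. For small `Z` commuting
with `h` this forces `Z = 0`: a nonzero `Z` shares an eigenvector with `h`, and its nonzero
eigenvalue there would be a difference of two of the finitely many eigenvalues of `h`
(`exists_pos_eq_zero_of_add_mem_adjointOrbit`). So the inverse is a slice chart at `h`
(`exists_slice`), and `Ad` carries it to every point of the orbit.

By invariance `B(x, [X, Y]) = B([x, X], Y)`, so the form is well defined. With `k = exp v` and `θ =
k⁻¹ dk`, its expression in every chart is `B(h, [θ, θ])`, which the Maurer–Cartan equation
identifies with `-d(B(h, θ))`; hence it is smooth and closed (`inChart_eq`). The Killing form is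
degenerate on the centre, but `B(Z, Z) = 0` makes `Z` central, and a central element of `range (ad
x)` is zero; this gives nondegeneracy (`lie_eq_zero_of_killingForm`). Invariance under `U(n)` holds
because `Ad g` is a Lie algebra automorphism. -/

noncomputable section

namespace UnitaryOrbit

/-! ### Submanifolds of a normed space cut out by slice charts -/

section Slices

variable {V E F : Type*} [NormedAddCommGroup V] [NormedSpace ℝ V] [NormedAddCommGroup E]
  [NormedSpace ℝ E] [NormedAddCommGroup F] [NormedSpace ℝ F]

variable (E F) in
/-- A slice chart of a subset `O` of a normed space: a diffeomorphism from an open subset to an open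
subset of `E × F`, under which `O` corresponds to `E × {0}`. -/
structure Slice (O : Set V) where
  /-- The underlying diffeomorphism. -/
  chart : OpenPartialHomeomorph V (E × F)
  contDiffOn : ContDiffOn ℝ ∞ chart chart.source
  contDiffOn_symm : ContDiffOn ℝ ∞ chart.symm chart.target
  mem_iff : ∀ y ∈ chart.source, y ∈ O ↔ (chart y).2 = 0

namespace Slice

variable {O : Set V}

/-- The image of a slice chart under a linear automorphism that preserves the subset. -/
def translate (S : Slice E F O) (L : V ≃L[ℝ] V) (hL : ∀ y, L y ∈ O ↔ y ∈ O) : Slice E F O where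
  chart := L.symm.toHomeomorph.toOpenPartialHomeomorph.trans S.chart
  contDiffOn := by
    refine S.contDiffOn.comp L.symm.contDiff.contDiffOn ?_
    intro y hy
    simpa using hy
  contDiffOn_symm := by
    refine L.contDiff.comp_contDiffOn (S.contDiffOn_symm.mono ?_)
    intro y hy
    simpa using hy
  mem_iff := by
    intro y hy
    have h1 : L.symm y ∈ S.chart.source := by simpa using hy
    have h2 := hL (L.symm y)
    rw [L.apply_symm_apply] at h2
    rw [h2]
    exact S.mem_iff _ h1

lemma translate_chart_apply (S : Slice E F O) (L : V ≃L[ℝ] V) (hL : ∀ y, L y ∈ O ↔ y ∈ O) (y : V) :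
    (S.translate L hL).chart y = S.chart (L.symm y) := rfl

lemma translate_chart_symm_apply (S : Slice E F O) (L : V ≃L[ℝ] V) (hL : ∀ y, L y ∈ O ↔ y ∈ O)
    (p : E × F) : (S.translate L hL).chart.symm p = L (S.chart.symm p) := rfl

lemma mem_translate_source (S : Slice E F O) (L : V ≃L[ℝ] V) (hL : ∀ y, L y ∈ O ↔ y ∈ O) (y : V) :
    y ∈ (S.translate L hL).chart.source ↔ L.symm y ∈ S.chart.source := by
  simp [translate]

lemma symm_mem (S : Slice E F O) {e : E} (he : (e, (0 : F)) ∈ S.chart.target) :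
    S.chart.symm (e, 0) ∈ O := by
  rw [S.mem_iff _ (S.chart.map_target he), S.chart.right_inv he]

lemma eq_of_mem (S : Slice E F O) {y : V} (hy : y ∈ S.chart.source) (hyO : y ∈ O) :
    ((S.chart y).1, (0 : F)) = S.chart y :=
  Prod.ext rfl ((S.mem_iff y hy).1 hyO).symm

open Classical in
/-- The chart of the subset `O` given by a slice chart. -/
def restr (S : Slice E F O) [Nonempty O] : OpenPartialHomeomorph O E where
  toFun y := (S.chart y).1
  -- The default value is never met on the target, by `symm_mem`.
  invFun e := if h : S.chart.symm (e, 0) ∈ O then ⟨_, h⟩ else Classical.arbitrary O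
  source := {y | (y : V) ∈ S.chart.source}
  target := {e | (e, (0 : F)) ∈ S.chart.target}
  map_source' := by
    intro y hy
    change _ ∈ S.chart.target
    rw [S.eq_of_mem hy y.2]
    exact S.chart.map_source hy
  map_target' := by
    intro e he
    rw [dif_pos (S.symm_mem he)]
    exact S.chart.map_target he
  left_inv' := by
    intro y hy
    have : S.chart.symm ((S.chart y).1, 0) = y := by
      rw [S.eq_of_mem hy y.2, S.chart.left_inv hy]
    simp [this]
  right_inv' := by
    intro e he
    rw [dif_pos (S.symm_mem he)]
    simp [S.chart.right_inv he]
  open_source := S.chart.open_source.preimage continuous_subtype_val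
  open_target := S.chart.open_target.preimage (by fun_prop)
  continuousOn_toFun := by
    refine continuous_fst.comp_continuousOn (S.chart.continuousOn.comp
      continuous_subtype_val.continuousOn ?_)
    exact fun y hy => hy
  continuousOn_invFun := by
    rw [Topology.IsEmbedding.subtypeVal.continuousOn_iff]
    refine (S.chart.continuousOn_symm.comp (f := fun e : E => (e, (0 : F)))
      (by fun_prop) (fun e he => he)).congr ?_
    intro e he
    simp [S.symm_mem he]

variable [Nonempty O]

lemma restr_apply (S : Slice E F O) (y : O) : S.restr y = (S.chart y).1 := rfl

lemma mem_restr_source (S : Slice E F O) (y : O) :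
    y ∈ S.restr.source ↔ (y : V) ∈ S.chart.source := Iff.rfl

open Classical in
lemma coe_restr_symm (S : Slice E F O) {e : E} (he : e ∈ S.restr.target) :
    (S.restr.symm e : V) = S.chart.symm (e, 0) := by
  change ((if h : S.chart.symm (e, 0) ∈ O then (⟨_, h⟩ : O) else Classical.arbitrary O : O) : V) = _
  rw [dif_pos (S.symm_mem he)]

lemma contDiffOn_symm_zero (S : Slice E F O) :
    ContDiffOn ℝ ∞ (fun e => S.chart.symm (e, 0)) S.restr.target :=
  S.contDiffOn_symm.comp (f := fun e : E => (e, (0 : F))) (by fun_prop) (fun e he => he)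

/-- The manifold structure on `O` given by slice charts around all of its points. -/
@[reducible]
def chartedSpace (S : O → Slice E F O) (hS : ∀ x, (x : V) ∈ (S x).chart.source) :
    ChartedSpace E O where
  atlas := Set.range fun x => (S x).restr
  chartAt x := (S x).restr
  mem_chart_source x := hS x
  chart_mem_atlas x := ⟨x, rfl⟩

variable (S : O → Slice E F O) (hS : ∀ x, (x : V) ∈ (S x).chart.source)

lemma isManifold : letI := chartedSpace S hS
    IsManifold 𝓘(ℝ, E) ∞ O := by
  let _ := chartedSpace S hS
  refine isManifold_of_contDiffOn _ _ _ ?_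
  rintro _ _ ⟨x, rfl⟩ ⟨y, rfl⟩
  simp only [modelWithCornersSelf_coe, modelWithCornersSelf_coe_symm, Function.comp_id,
    Function.id_comp, Set.range_id, Set.inter_univ, Set.preimage_id]
  have h : ContDiffOn ℝ ∞ (fun e => ((S y).chart ((S x).chart.symm (e, 0))).1)
      ((S x).restr.symm.trans (S y).restr).source := by
    refine contDiff_fst.comp_contDiffOn ((S y).contDiffOn.comp
      ((S x).contDiffOn_symm_zero.mono ?_) ?_)
    · intro e he
      exact he.1
    · intro e he
      have h2 := he.2
      have h1 : e ∈ (S x).restr.target := he.1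
      change ((S x).restr.symm e : V) ∈ (S y).chart.source at h2
      rwa [coe_restr_symm _ h1] at h2
  refine h.congr ?_
  intro e he
  have h1 : e ∈ (S x).restr.target := he.1
  change ((S y).chart ((S x).restr.symm e)).1 = _
  rw [coe_restr_symm _ h1]

/-- `L` turns the slice chart into a chart with values in `V` itself; there the inclusion reads `e ↦
L (e, 0)`. -/
lemma isSmoothEmbedding (L : (E × F) ≃L[ℝ] V) : letI := chartedSpace S hS
    Manifold.IsSmoothEmbedding 𝓘(ℝ, E) 𝓘(ℝ, V) ∞ (Subtype.val : O → V) := by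
  let _ := chartedSpace S hS
  have := isManifold S hS
  refine ⟨Manifold.IsImmersionOfComplement.isImmersion (F := F) fun x => ?_,
    Topology.IsEmbedding.subtypeVal⟩
  refine Manifold.IsImmersionAtOfComplement.mk_of_charts L (S x).restr
    ((S x).chart.trans L.toHomeomorph.toOpenPartialHomeomorph) (hS x) ?_ ?_ ?_ ?_ ?_
  · simpa using hS x
  · exact IsManifold.chart_mem_maximalAtlas (I := 𝓘(ℝ, E)) (n := ∞) x
  · refine OpenPartialHomeomorph.mem_maximalAtlas_of_contMDiffOn (I := 𝓘(ℝ, V)) _ ?_ ?_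
    · rw [contMDiffOn_iff_contDiffOn]
      refine L.contDiff.comp_contDiffOn ((S x).contDiffOn.mono ?_)
      intro y hy
      simpa using hy
    · rw [contMDiffOn_iff_contDiffOn]
      refine (S x).contDiffOn_symm.comp L.symm.contDiff.contDiffOn ?_
      intro y hy
      simpa using hy
  · intro y hy
    rw [mem_restr_source] at hy
    simpa using hy
  · intro e he
    have he' : e ∈ (S x).restr.target := by simpa using he
    have := coe_restr_symm (S x) he'
    have h2 := (S x).chart.right_inv he'
    simp [this, h2]

/-- The preferred chart at `x` is `(S x).restr`, and the tangent space at `x` is the model space by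
way of that chart. -/
lemma mfderiv_val (L : (E × F) ≃L[ℝ] V) (x : O) : letI := chartedSpace S hS
    (mfderiv 𝓘(ℝ, E) 𝓘(ℝ, V) (Subtype.val : O → V) x : E →L[ℝ] V) =
      fderiv ℝ (fun e => (S x).chart.symm (e, 0)) ((S x).restr x) := by
  let _ := chartedSpace S hS
  have := isManifold S hS
  have h1 : MDifferentiableAt 𝓘(ℝ, E) 𝓘(ℝ, V) (Subtype.val : O → V) x :=
    ((isSmoothEmbedding S hS L).contMDiff _).mdifferentiableAt (by simp)
  rw [h1.mfderiv]
  have h2 : (writtenInExtChartAt 𝓘(ℝ, E) 𝓘(ℝ, V) x (Subtype.val : O → V)) =ᶠ[nhds ((S x).restr x)]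
      fun e => (S x).chart.symm (e, 0) := by
    filter_upwards [(S x).restr.open_target.mem_nhds ((S x).restr.map_source (hS x))] with e he
    exact coe_restr_symm _ he
  rw [← h2.fderiv_eq]
  simp only [modelWithCornersSelf_coe, Set.range_id, fderivWithin_univ]
  rfl

/-- Away from `x` the preferred chart may be a different one; the chain rule for `val ∘ (S
x).restr.symm` removes this dependence. -/
lemma mfderiv_val_mfderiv_symm (L : (E × F) ≃L[ℝ] V) (x : O) {e : E}
    (he : e ∈ (S x).restr.target) (v : E) : letI := chartedSpace S hS
    mfderiv 𝓘(ℝ, E) 𝓘(ℝ, V) (Subtype.val : O → V) ((S x).restr.symm e)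
      (mfderiv 𝓘(ℝ, E) 𝓘(ℝ, E) (S x).restr.symm e v) =
      fderiv ℝ (fun e => (S x).chart.symm (e, 0)) e v := by
  let _ := chartedSpace S hS
  have := isManifold S hS
  have h1 : MDifferentiableAt 𝓘(ℝ, E) 𝓘(ℝ, V) (Subtype.val : O → V) ((S x).restr.symm e) :=
    ((isSmoothEmbedding S hS L).contMDiff _).mdifferentiableAt (by simp)
  have h2 : MDifferentiableAt 𝓘(ℝ, E) 𝓘(ℝ, E) (S x).restr.symm e :=
    mdifferentiableAt_atlas_symm (I := 𝓘(ℝ, E)) (ChartedSpace.chart_mem_atlas x) he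
  have h3 := mfderiv_comp e h1 h2
  have h4 : (Subtype.val ∘ (S x).restr.symm : E → V) =ᶠ[nhds e]
      fun e => (S x).chart.symm (e, 0) := by
    filter_upwards [(S x).restr.open_target.mem_nhds he] with e' he'
    exact coe_restr_symm _ he'
  rw [← h4.fderiv_eq, ← mfderiv_eq_fderiv, h3]
  rfl

end Slice

end Slices

attribute [local instance] LieRing.ofAssociativeRing

/-! ### The Lie algebra `𝔲(n)`: invariant forms and eigenvalues -/

section Algebra

variable {n : ℕ}

lemma conjTranspose_coe (X : u n) : (X : Matrix (Fin n) (Fin n) ℂ)ᴴ = -X :=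
  (neg_eq_of_add_eq_zero_right X.2).symm

lemma coe_lie (X Y : u n) : ((⁅X, Y⁆ : u n) : Matrix (Fin n) (Fin n) ℂ) = X * Y - Y * X := by
  rw [LieSubalgebra.coe_bracket, Ring.lie_def]

lemma coe_Ad (g : Matrix.unitaryGroup (Fin n) ℂ) (X : u n) :
    (Ad g X : Matrix (Fin n) (Fin n) ℂ) = g * X * (g : Matrix (Fin n) (Fin n) ℂ)ᴴ := rfl

lemma Ad_mul (g k : Matrix.unitaryGroup (Fin n) ℂ) (X : u n) : Ad (g * k) X = Ad g (Ad k X) := by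
  refine Subtype.ext ?_
  simp [coe_Ad, mul_assoc]

lemma Ad_one (X : u n) : Ad 1 X = X := Subtype.ext (by simp [coe_Ad])

lemma conjTranspose_mul_self (g : Matrix.unitaryGroup (Fin n) ℂ) :
    (g : Matrix (Fin n) (Fin n) ℂ)ᴴ * g = 1 := Unitary.coe_star_mul_self g

lemma mul_conjTranspose_self (g : Matrix.unitaryGroup (Fin n) ℂ) :
    (g : Matrix (Fin n) (Fin n) ℂ) * (g : Matrix (Fin n) (Fin n) ℂ)ᴴ = 1 :=
  Unitary.coe_mul_star_self g

/-- The adjoint action of a unitary matrix as an automorphism of the Lie algebra `𝔲(n)`. -/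
def AdEquiv (g : Matrix.unitaryGroup (Fin n) ℂ) : u n ≃ₗ⁅ℝ⁆ u n where
  toFun := Ad g
  invFun := Ad g⁻¹
  map_add' X Y := Subtype.ext (by simp [coe_Ad, mul_add, add_mul])
  map_smul' c X := Subtype.ext (by simp [coe_Ad])
  map_lie' := by
    intro X Y
    refine Subtype.ext ?_
    have h : ∀ M : Matrix (Fin n) (Fin n) ℂ, (g : Matrix (Fin n) (Fin n) ℂ)ᴴ * (g * M) = M := by
      intro M
      rw [← mul_assoc, conjTranspose_mul_self, one_mul]
    simp only [coe_Ad, coe_lie, mul_sub, sub_mul, mul_assoc, h]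
  left_inv X := by rw [← Ad_mul, inv_mul_cancel, Ad_one]
  right_inv X := by rw [← Ad_mul, mul_inv_cancel, Ad_one]

lemma Ad_lie (g : Matrix.unitaryGroup (Fin n) ℂ) (X Y : u n) : Ad g ⁅X, Y⁆ = ⁅Ad g X, Ad g Y⁆ :=
  (AdEquiv g).map_lie X Y

instance instFiniteDimensional : FiniteDimensional ℝ (u n) :=
  inferInstanceAs (FiniteDimensional ℝ (u n).toSubmodule)

/-- The inner product `Re tr(Xᴴ Y)` on `𝔲(n)`. -/
def traceInner (n : ℕ) : LinearMap.BilinForm ℝ (u n) :=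
  LinearMap.mk₂ ℝ (fun X Y => ((X : Matrix (Fin n) (Fin n) ℂ)ᴴ * Y).trace.re)
    (fun X Y Z => by simp [add_mul]) (fun c X Y => by simp)
    (fun X Y Z => by simp [mul_add]) (fun c X Y => by simp)

lemma traceInner_apply (X Y : u n) :
    traceInner n X Y = ((X : Matrix (Fin n) (Fin n) ℂ)ᴴ * Y).trace.re := rfl

lemma traceInner_comm (X Y : u n) : traceInner n X Y = traceInner n Y X := by
  rw [traceInner_apply, traceInner_apply, conjTranspose_coe, conjTranspose_coe, neg_mul, neg_mul,
    Matrix.trace_neg, Matrix.trace_neg, Matrix.trace_mul_comm]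

/-- Cyclicity of the trace. This skewness of `ad Z` underlies both the tangent-normal splitting and
the semidefiniteness of the Killing form. -/
lemma traceInner_lie (Z X Y : u n) : traceInner n ⁅Z, X⁆ Y = -traceInner n X ⁅Z, Y⁆ := by
  rw [traceInner_apply, traceInner_apply, conjTranspose_coe, conjTranspose_coe, coe_lie, coe_lie]
  simp only [neg_mul, Matrix.trace_neg, sub_mul, mul_sub, Matrix.trace_sub, Complex.neg_re,
    Complex.sub_re, ← mul_assoc]
  rw [Matrix.trace_mul_cycle (X : Matrix (Fin n) (Fin n) ℂ) (Y : Matrix (Fin n) (Fin n) ℂ)]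
  ring

open ComplexOrder in
lemma traceInner_self_nonneg (X : u n) : 0 ≤ traceInner n X X :=
  (Complex.nonneg_iff.1 (Matrix.PosSemidef.trace_nonneg
    (Matrix.posSemidef_conjTranspose_mul_self (X : Matrix (Fin n) (Fin n) ℂ)))).1

open ComplexOrder in
lemma eq_zero_of_traceInner_self {X : u n} (h : traceInner n X X = 0) : X = 0 := by
  have h1 := Complex.nonneg_iff.1 (Matrix.PosSemidef.trace_nonneg
    (Matrix.posSemidef_conjTranspose_mul_self (X : Matrix (Fin n) (Fin n) ℂ)))
  refine Subtype.ext (Matrix.trace_conjTranspose_mul_self_eq_zero_iff.1 ?_)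
  exact Complex.ext h h1.2.symm

/-- An endomorphism that is skew for an inner product and whose square has trace zero vanishes. -/
lemma eq_zero_of_trace_comp_self {W : Type*} [AddCommGroup W] [Module ℝ W] [FiniteDimensional ℝ W]
    (q : LinearMap.BilinForm ℝ W) (hq : ∀ x y, q x y = q y x) (hq0 : ∀ x, 0 ≤ q x x)
    (hq1 : ∀ x, q x x = 0 → x = 0) (T : W →ₗ[ℝ] W) (hT : ∀ x y, q (T x) y = -q x (T y))
    (htr : LinearMap.trace ℝ W (T ∘ₗ T) = 0) : T = 0 := by
  obtain ⟨v, hv⟩ := LinearMap.BilinForm.exists_orthogonal_basis (B := q)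
    ⟨hq⟩
  have hpos : ∀ i, 0 < q (v i) (v i) := fun i =>
    lt_of_le_of_ne (hq0 _) fun h => v.ne_zero i (hq1 _ h.symm)
  have hrepr : ∀ i x, q (v i) x = q (v i) (v i) * v.repr x i := by
    intro i x
    conv_lhs => rw [← v.sum_repr x]
    rw [map_sum, Finset.sum_eq_single i]
    · simp [mul_comm]
    · intro j _ hj
      have : q (v i) (v j) = 0 := hv hj.symm
      simp [this]
    · simp
  -- The trace of `T²` thus becomes minus a sum of the nonnegative terms `q(T vᵢ, T vᵢ) / q(vᵢ,
  -- vᵢ)`.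
  have hdiag : ∀ i, v.repr (T (T (v i))) i = -(q (T (v i)) (T (v i)) / q (v i) (v i)) := by
    intro i
    have h1 := hrepr i (T (T (v i)))
    have h2 := hT (v i) (T (v i))
    have h3 := (hpos i).ne'
    field_simp
    linarith
  rw [LinearMap.trace_eq_matrix_trace ℝ v, Matrix.trace] at htr
  simp only [Matrix.diag_apply, LinearMap.toMatrix_apply, LinearMap.comp_apply, hdiag,
    Finset.sum_neg_distrib, neg_eq_zero] at htr
  rw [Finset.sum_eq_zero_iff_of_nonneg
    (fun i _ => div_nonneg (hq0 _) (hpos i).le)] at htr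
  refine v.ext fun i => ?_
  have h1 := htr i (Finset.mem_univ _)
  rw [div_eq_zero_iff, or_iff_left (hpos i).ne'] at h1
  exact hq1 _ h1

lemma killingForm_lie_apply (X Y Z : u n) :
    killingForm ℝ (u n) ⁅X, Y⁆ Z = killingForm ℝ (u n) X ⁅Y, Z⁆ :=
  LieModule.traceForm_apply_lie_apply ℝ (u n) (u n) X Y Z

lemma ad_eq_zero_of_killingForm_self {X : u n} (h : killingForm ℝ (u n) X X = 0) :
    LieAlgebra.ad ℝ (u n) X = 0 :=
  eq_zero_of_trace_comp_self (traceInner n) traceInner_comm traceInner_self_nonneg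
    (fun _ => eq_zero_of_traceInner_self) _ (fun Y Z => traceInner_lie X Y Z) h

/-- On the semisimple part of `𝔲(n)` the Killing form is nondegenerate. -/
lemma lie_eq_zero_of_killingForm {x X : u n} (h : ∀ Y, killingForm ℝ (u n) ⁅x, X⁆ Y = 0) :
    ⁅x, X⁆ = 0 := by
  -- Taking `Y = [x, X]` in the hypothesis shows that `[x, X]` is central; skewness of `ad x` then
  -- makes it orthogonal to itself.
  have h1 : ∀ Y : u n, ⁅⁅x, X⁆, Y⁆ = 0 := fun Y =>
    LinearMap.congr_fun (ad_eq_zero_of_killingForm_self (h _)) Y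
  refine eq_zero_of_traceInner_self ?_
  rw [traceInner_lie, ← lie_skew x, h1]
  simp

/-- If `[x, [x, X]] = 0`, then `⟨[x, X], [x, X]⟩ = -⟨X, [x, [x, X]]⟩ = 0`. The dimensions match by
rank-nullity. -/
lemma isCompl_range_ker_ad (x : u n) :
    IsCompl (LinearMap.range (LieAlgebra.ad ℝ (u n) x : u n →ₗ[ℝ] u n))
      (LinearMap.ker (LieAlgebra.ad ℝ (u n) x : u n →ₗ[ℝ] u n)) := by
  refine Submodule.isCompl_iff_disjoint _ _ ?_ |>.2 ?_
  · rw [LinearMap.finrank_range_add_finrank_ker]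
  · rw [Submodule.disjoint_def]
    rintro _ ⟨X, rfl⟩ hX
    rw [LinearMap.mem_ker, LieAlgebra.ad_apply, LieAlgebra.ad_apply] at hX
    refine eq_zero_of_traceInner_self ?_
    rw [LieAlgebra.ad_apply, traceInner_lie, hX]
    simp

/-- The matrix `iZ` is Hermitian, so it vanishes if all its eigenvalues do; an eigenvalue `μ` of
`iZ` gives `-iμ` for `Z`. -/
lemma exists_eigenvalue_ne_zero {Z : u n} (hZ : Z ≠ 0) :
    ∃ ζ : ℂ, ζ ≠ 0 ∧
      Module.End.HasEigenvalue (Matrix.toLin' (Z : Matrix (Fin n) (Fin n) ℂ)) ζ := by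
  have hH : (Complex.I • (Z : Matrix (Fin n) (Fin n) ℂ)).IsHermitian := by
    rw [Matrix.IsHermitian, Matrix.conjTranspose_smul, conjTranspose_coe]
    simp
  have h1 : hH.eigenvalues ≠ 0 := by
    intro h
    rw [hH.eigenvalues_eq_zero_iff] at h
    exact hZ (Subtype.ext ((smul_eq_zero.1 h).resolve_left Complex.I_ne_zero))
  obtain ⟨i, hi⟩ := Function.ne_iff.1 h1
  refine ⟨-(Complex.I * hH.eigenvalues i), by simpa using hi, ?_⟩
  have h2 := hH.mulVec_eigenvectorBasis i
  have h3 : (hH.eigenvectorBasis i : Fin n → ℂ) ≠ 0 := by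
    intro h
    exact hH.eigenvectorBasis.orthonormal.ne_zero i (WithLp.ofLp_injective 2 h)
  refine Module.End.hasEigenvalue_of_hasEigenvector (x := (hH.eigenvectorBasis i : Fin n → ℂ))
    ⟨Module.End.mem_eigenspace_iff.2 ?_, h3⟩
  rw [Matrix.toLin'_apply, neg_smul, mul_smul, Complex.coe_smul, ← h2, Matrix.smul_mulVec,
    smul_smul]
  simp

/-- Since `h` commutes with `Z`, it preserves an eigenspace of `Z` for a nonzero eigenvalue and has
an eigenvector in it. -/
lemma exists_common_eigenvector {h Z : u n} (hZ : Z ≠ 0) (hc : ⁅h, Z⁆ = 0) :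
    ∃ (a ζ : ℂ) (w : Fin n → ℂ), ζ ≠ 0 ∧ w ≠ 0 ∧
      (h : Matrix (Fin n) (Fin n) ℂ) *ᵥ w = a • w ∧
      (Z : Matrix (Fin n) (Fin n) ℂ) *ᵥ w = ζ • w := by
  obtain ⟨ζ, hζ, hev⟩ := exists_eigenvalue_ne_zero hZ
  have hcomm : Commute (Matrix.toLin' (Z : Matrix (Fin n) (Fin n) ℂ))
      (Matrix.toLin' (h : Matrix (Fin n) (Fin n) ℂ)) := by
    have := congrArg Subtype.val hc
    rw [coe_lie] at this
    rw [commute_iff_eq, Module.End.mul_eq_comp, Module.End.mul_eq_comp, ← Matrix.toLin'_mul,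
      ← Matrix.toLin'_mul, sub_eq_zero.1 this]
  have hmaps := Module.End.mapsTo_genEigenspace_of_comm hcomm ζ 1
  have hne : Nontrivial (Module.End.eigenspace
      (Matrix.toLin' (Z : Matrix (Fin n) (Fin n) ℂ)) ζ) :=
    Submodule.nontrivial_iff_ne_bot.2 hev
  obtain ⟨a, ha⟩ := Module.End.exists_eigenvalue
    ((Matrix.toLin' (h : Matrix (Fin n) (Fin n) ℂ)).restrict hmaps)
  obtain ⟨w, hw⟩ := ha.exists_hasEigenvector
  refine ⟨a, ζ, w, hζ, fun h0 => hw.2 (Subtype.ext h0), ?_, ?_⟩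
  · exact congrArg Subtype.val hw.apply_eq_smul
  · simpa using Module.End.mem_eigenspace_iff.1 w.2

/-- On a common eigenvector `h` and `Z` act by `a` and `ζ ≠ 0`. Since `h + Z` is conjugate to `h`,
both `a` and `a + ζ` are eigenvalues of `h`, so `ζ` belongs to a finite set of nonzero differences.
-/
lemma exists_pos_eq_zero_of_add_mem_adjointOrbit (h : u n) : ∃ ε > 0, ∀ Z : u n,
    (∀ a ∈ spectrum ℂ (Z : Matrix (Fin n) (Fin n) ℂ), ‖a‖ < ε) → ⁅h, Z⁆ = 0 →
      h + Z ∈ adjointOrbit h → Z = 0 := by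
  set D : Set ℂ := {a | Module.End.HasEigenvalue
    (Matrix.toLin' (h : Matrix (Fin n) (Fin n) ℂ)) a} with hD
  have hfin : D.Finite := Module.End.finite_hasEigenvalue _
  have hfin2 : (Set.image2 (fun a b : ℂ => a - b) D D \ {0}).Finite :=
    (hfin.image2 _ hfin).subset Set.sdiff_subset
  -- The ball of radius `ε` about `0` contains no nonzero difference of eigenvalues of `h`.
  obtain ⟨ε, hε, hsub⟩ := Metric.isOpen_iff.1 hfin2.isClosed.isOpen_compl 0 (by simp)
  refine ⟨ε, hε, fun Z hZ hc ⟨g, hg⟩ => ?_⟩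
  by_contra hne
  obtain ⟨a, ζ, w, hζ, hw, hha, hZa⟩ := exists_common_eigenvector hne hc
  have h1 : a ∈ D := Module.End.hasEigenvalue_of_hasEigenvector (x := w)
    ⟨Module.End.mem_eigenspace_iff.2 (by simpa using hha), hw⟩
  have h2 : (g : Matrix (Fin n) (Fin n) ℂ) *ᵥ ((g : Matrix (Fin n) (Fin n) ℂ)ᴴ *ᵥ w) = w := by
    rw [Matrix.mulVec_mulVec, mul_conjTranspose_self, Matrix.one_mulVec]
  -- As `h + Z = g h gᴴ`, the vector `gᴴ w` is an eigenvector of `h`.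
  have h3 : a + ζ ∈ D := by
    refine Module.End.hasEigenvalue_of_hasEigenvector
      (x := (g : Matrix (Fin n) (Fin n) ℂ)ᴴ *ᵥ w)
      ⟨Module.End.mem_eigenspace_iff.2 ?_, fun h0 => hw (by rw [← h2, h0, Matrix.mulVec_zero])⟩
    have h4 := congrArg Subtype.val hg
    rw [coe_Ad] at h4
    have h5 : (h : Matrix (Fin n) (Fin n) ℂ) * (g : Matrix (Fin n) (Fin n) ℂ)ᴴ =
        (g : Matrix (Fin n) (Fin n) ℂ)ᴴ * ((h + Z : u n) : Matrix (Fin n) (Fin n) ℂ) := by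
      rw [h4, ← mul_assoc, ← mul_assoc, conjTranspose_mul_self, one_mul]
    rw [Matrix.toLin'_apply, Matrix.mulVec_mulVec, h5, ← Matrix.mulVec_mulVec, ← Matrix.mulVec_smul]
    congr 1
    rw [add_smul, ← hha, ← hZa, ← Matrix.add_mulVec]
    rfl
  have h6 : ζ ∈ spectrum ℂ (Z : Matrix (Fin n) (Fin n) ℂ) := by
    rw [← Matrix.spectrum_toLin']
    exact (Module.End.hasEigenvalue_of_hasEigenvector (x := w)
      ⟨Module.End.mem_eigenspace_iff.2 (by simpa using hZa), hw⟩).mem_spectrum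
  exact hsub (a := ζ) (by simpa using hZ ζ h6) ⟨⟨a + ζ, h3, a, h1, by simp⟩, hζ⟩

end Algebra

/-! ### The matrix exponential and real-linear maps on matrices -/

section Exponential

attribute [local instance] Matrix.linftyOpNormedRing Matrix.linftyOpNormedAlgebra
  Matrix.linftyOpNormedAddCommGroup Matrix.linftyOpNormedSpace

variable {n : ℕ}

lemma exists_nhds_eq_zero_of_add_mem_adjointOrbit (h : u n) : ∃ U : Set (u n), IsOpen U ∧ 0 ∈ U ∧
    ∀ Z ∈ U, ⁅h, Z⁆ = 0 → h + Z ∈ adjointOrbit h → Z = 0 := by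
  obtain ⟨ε, hε, H⟩ := exists_pos_eq_zero_of_add_mem_adjointOrbit h
  -- The norm bounds the spectrum up to the factor `‖1‖`, which is `0` when `n = 0`.
  refine ⟨{Z : u n | ‖(Z : Matrix (Fin n) (Fin n) ℂ)‖ * ‖(1 : Matrix (Fin n) (Fin n) ℂ)‖ < ε},
    ?_, by simpa using hε, fun Z hZ => H Z fun a ha => ?_⟩
  · refine isOpen_lt ?_ continuous_const
    exact (continuous_norm.comp continuous_subtype_val).mul continuous_const
  · exact (spectrum.norm_le_norm_mul_of_mem ha).trans_lt hZ

instance instContinuousSMul : ContinuousSMul ℝ (u n) :=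
  @IsBoundedSMul.continuousSMul ℝ (u n) _ (instNormedAddCommGroup n).toPseudoMetricSpace _ _ _
    (@NormedSpace.toIsBoundedSMul ℝ (u n) _ _ (instNormedSpace n))

/-- The Banach algebra of complex matrices. -/
def Mat (n : ℕ) : Type := Matrix (Fin n) (Fin n) ℂ

instance instNormedRingMat : NormedRing (Mat n) := Matrix.linftyOpNormedRing

instance instNormedAlgebraMat : NormedAlgebra ℝ (Mat n) := Matrix.linftyOpNormedAlgebra

instance instCompleteSpaceMat : CompleteSpace (Mat n) := Matrix.instCompleteSpace (Fin n) (Fin n) ℂ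

/-- The exponential of a skew-Hermitian matrix, a unitary matrix. -/
def expU (X : u n) : Matrix.unitaryGroup (Fin n) ℂ :=
  ⟨NormedSpace.exp (X : Matrix (Fin n) (Fin n) ℂ), by
    rw [Matrix.mem_unitaryGroup_iff, Matrix.star_eq_conjTranspose, ← Matrix.exp_conjTranspose,
      conjTranspose_coe, ← Matrix.exp_add_of_commute _ _
        (Commute.neg_right (Commute.refl (X : Matrix (Fin n) (Fin n) ℂ))), add_neg_cancel,
      NormedSpace.exp_zero]⟩

variable (n) in
/-- The inclusion of `𝔲(n)` into the space of matrices. -/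
def coeL : u n →L[ℝ] Mat n where
  toFun X := (X : Matrix (Fin n) (Fin n) ℂ)
  map_add' _ _ := rfl
  map_smul' _ _ := rfl
  cont := continuous_subtype_val (X := Matrix (Fin n) (Fin n) ℂ)

variable (n) in
/-- The conjugate transpose as a real-linear map. -/
def adjL : Mat n →L[ℝ] Mat n where
  toFun M := Matrix.conjTranspose M
  map_add' := Matrix.conjTranspose_add
  map_smul' c M := (Matrix.conjTranspose_smul c M).trans (by rw [star_trivial]; rfl)
  cont := (continuous_id (X := Matrix (Fin n) (Fin n) ℂ)).matrix_conjTranspose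

lemma adjL_adjL (M : Mat n) : adjL n (adjL n M) = M := Matrix.conjTranspose_conjTranspose M

lemma adjL_mul (M N : Mat n) : adjL n (M * N) = adjL n N * adjL n M :=
  Matrix.conjTranspose_mul M N

lemma adjL_coeL (X : u n) : adjL n (coeL n X) = -coeL n X := conjTranspose_coe X

variable (n) in
/-- The projection of a matrix to its skew-Hermitian part. -/
def skewL : Mat n →L[ℝ] u n where
  toFun M := ⟨(2⁻¹ : ℝ) • (M - adjL n M), by
    change (2⁻¹ : ℝ) • (M - adjL n M) + adjL n ((2⁻¹ : ℝ) • (M - adjL n M)) = 0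
    rw [map_smul, map_sub, adjL_adjL, ← smul_add, sub_add_sub_cancel, sub_self, smul_zero]⟩
  map_add' M N := Subtype.ext <|
    show (2⁻¹ : ℝ) • (M + N - adjL n (M + N)) =
        (2⁻¹ : ℝ) • (M - adjL n M) + (2⁻¹ : ℝ) • (N - adjL n N) by
      rw [map_add, add_sub_add_comm, smul_add]
  map_smul' c M := Subtype.ext <|
    show (2⁻¹ : ℝ) • (c • M - adjL n (c • M)) = c • (2⁻¹ : ℝ) • (M - adjL n M) by
      rw [map_smul, ← smul_sub, smul_comm]
  cont := by
    have h : Continuous fun M : Mat n => (2⁻¹ : ℝ) • (M - adjL n M) := by fun_prop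
    exact h.subtype_mk (X := Matrix (Fin n) (Fin n) ℂ) _

lemma coeL_skewL {M : Mat n} (hM : adjL n M = -M) : coeL n (skewL n M) = M := by
  change (2⁻¹ : ℝ) • (M - adjL n M) = M
  rw [hM, sub_neg_eq_add, ← two_smul ℝ, smul_smul]
  norm_num

lemma skewL_coeL (X : u n) : skewL n (coeL n X) = X :=
  Subtype.ext (coeL_skewL (adjL_coeL X))

lemma coeL_lie (X Y : u n) : coeL n ⁅X, Y⁆ = coeL n X * coeL n Y - coeL n Y * coeL n X :=
  coe_lie X Y

/-- A unitary matrix as an element of the algebra of matrices. -/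
def toMat (g : Matrix.unitaryGroup (Fin n) ℂ) : Mat n := (g : Matrix (Fin n) (Fin n) ℂ)

lemma adjL_mul_toMat (g : Matrix.unitaryGroup (Fin n) ℂ) : adjL n (toMat g) * toMat g = 1 :=
  conjTranspose_mul_self g

lemma toMat_mul_adjL (g : Matrix.unitaryGroup (Fin n) ℂ) : toMat g * adjL n (toMat g) = 1 :=
  mul_conjTranspose_self g

lemma Ad_eq_skewL (g : Matrix.unitaryGroup (Fin n) ℂ) (X : u n) :
    Ad g X = skewL n (toMat g * coeL n X * adjL n (toMat g)) :=
  (skewL_coeL (Ad g X)).symm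

lemma expU_zero : expU (0 : u n) = 1 := Subtype.ext NormedSpace.exp_zero

lemma contDiff_toMat_expU : ContDiff ℝ ∞ fun X : u n => toMat (expU X) := by
  refine contDiff_iff_contDiffAt.2 fun X => ?_
  have h1 : ContDiffAt ℝ ∞ (NormedSpace.exp : Mat n → Mat n) (coeL n X) :=
    (NormedSpace.exp_analytic (𝕂 := ℝ) _).contDiffAt
  exact h1.comp X (coeL n).contDiff.contDiffAt

lemma hasFDerivAt_toMat_expU_zero : HasFDerivAt (fun X : u n => toMat (expU X)) (coeL n) 0 := by
  have h1 : HasFDerivAt (NormedSpace.exp : Mat n → Mat n) (1 : Mat n →L[ℝ] Mat n) (coeL n 0) := by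
    rw [map_zero]
    exact (hasStrictFDerivAt_exp_zero (𝕂 := ℝ)).hasFDerivAt
  exact h1.comp 0 (coeL n).hasFDerivAt

end Exponential

/-! ### The Maurer–Cartan form -/

section MaurerCartan

variable {n : ℕ} {E : Type*} [NormedAddCommGroup E] [NormedSpace ℝ E]
  (k : E → Matrix.unitaryGroup (Fin n) ℂ)

/-- The pullback `k⁻¹ dk` of the Maurer–Cartan form under a map `k` into the unitary group. -/
def maurerCartan (e : E) : E →L[ℝ] u n :=
  (skewL n).comp ((ContinuousLinearMap.mul ℝ _ (adjL n (toMat (k e)))).comp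
    (fderiv ℝ (fun e => toMat (k e)) e))

variable {k} (hk : ContDiff ℝ ∞ fun e => toMat (k e))

include hk

lemma contDiff_maurerCartan : ContDiff ℝ ∞ (maurerCartan k) := by
  have h1 : ContDiff ℝ ∞ fun e => adjL n (toMat (k e)) := (adjL n).contDiff.comp hk
  have h2 : ContDiff ℝ ∞ (fderiv ℝ fun e => toMat (k e)) := hk.fderiv_right (by simp)
  exact contDiff_const.clm_comp
    (((ContinuousLinearMap.mul ℝ (Mat n)).contDiff.comp h1).clm_comp h2)

lemma hasFDerivAt_toMat (e : E) :
    HasFDerivAt (fun e => toMat (k e)) (fderiv ℝ (fun e => toMat (k e)) e) e :=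
  (hk.differentiable (by simp)).differentiableAt.hasFDerivAt

/-- Differentiating `kᴴ k = 1` shows that `kᴴ dk` is already skew-Hermitian, so the projection
`skewL` changes nothing. -/
lemma coeL_maurerCartan (e v : E) : coeL n (maurerCartan k e v) =
    adjL n (toMat (k e)) * fderiv ℝ (fun e => toMat (k e)) e v := by
  have hd := hasFDerivAt_toMat hk e
  have h1 := ((adjL n).hasFDerivAt.comp e hd).mul' hd
  have h2 : HasFDerivAt (fun _ => (1 : Mat n)) _ e :=
    h1.congr_of_eventuallyEq (.of_forall fun e => (adjL_mul_toMat (k e)).symm)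
  have h3 := congrArg (fun T => T v) (h2.unique (hasFDerivAt_const _ _))
  refine coeL_skewL (M := adjL n (toMat (k e)) * fderiv ℝ (fun e => toMat (k e)) e v) ?_
  rw [adjL_mul, adjL_adjL]
  exact (neg_eq_of_add_eq_zero_right h3).symm

lemma fderiv_toMat (e v : E) :
    fderiv ℝ (fun e => toMat (k e)) e v = toMat (k e) * coeL n (maurerCartan k e v) := by
  rw [coeL_maurerCartan hk, ← mul_assoc, toMat_mul_adjL, one_mul]

/-- Product rule for `k h kᴴ` with `dk = k θ` and `dkᴴ = -θ kᴴ`. -/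
lemma fderiv_Ad (h : u n) (e v : E) :
    fderiv ℝ (fun e => Ad (k e) h) e v = Ad (k e) ⁅maurerCartan k e v, h⁆ := by
  have hd := hasFDerivAt_toMat hk e
  have h1 := (skewL n).hasFDerivAt.comp e
    ((hd.mul_const' (coeL n h)).mul' ((adjL n).hasFDerivAt.comp e hd))
  have h2 := h1.congr_of_eventuallyEq (f₁ := fun e => Ad (k e) h)
    (.of_forall fun e => Ad_eq_skewL (k e) h)
  rw [h2.fderiv, Ad_eq_skewL]
  change skewL n (toMat (k e) * coeL n h * adjL n (fderiv ℝ (fun e => toMat (k e)) e v) +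
    fderiv ℝ (fun e => toMat (k e)) e v * coeL n h * adjL n (toMat (k e))) = _
  rw [fderiv_toMat hk, adjL_mul, adjL_coeL, coeL_lie]
  congr 1
  simp only [mul_sub, sub_mul, mul_assoc, mul_neg, neg_mul]
  abel

/-- The Maurer–Cartan equation. -/
lemma fderiv_maurerCartan (e v w : E) :
    fderiv ℝ (maurerCartan k) e v w - fderiv ℝ (maurerCartan k) e w v =
      -⁅maurerCartan k e v, maurerCartan k e w⁆ := by
  have hd := hasFDerivAt_toMat hk e
  have hd2 : HasFDerivAt (fderiv ℝ fun e => toMat (k e))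
      (fderiv ℝ (fderiv ℝ fun e => toMat (k e)) e) e :=
    ((hk.fderiv_right (m := ∞) (by simp)).differentiable (by simp)).differentiableAt.hasFDerivAt
  have key : ∀ v w, fderiv ℝ (maurerCartan k) e v w = skewL n
      (adjL n (toMat (k e)) * fderiv ℝ (fderiv ℝ fun e => toMat (k e)) e v w +
        adjL n (fderiv ℝ (fun e => toMat (k e)) e v) * fderiv ℝ (fun e => toMat (k e)) e w) := by
    intro v w
    have h1 := (contDiff_maurerCartan hk).differentiable (by simp) e
    have h2 : HasFDerivAt (fun e => maurerCartan k e w)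
        ((ContinuousLinearMap.apply ℝ (u n) w).comp (fderiv ℝ (maurerCartan k) e)) e :=
      (ContinuousLinearMap.apply ℝ (u n) w).hasFDerivAt.comp e h1.hasFDerivAt
    have h3 := (skewL n).hasFDerivAt.comp e (((adjL n).hasFDerivAt.comp e hd).mul'
      ((ContinuousLinearMap.apply ℝ (Mat n) w).hasFDerivAt.comp e hd2))
    exact congrArg (fun T => T v) (h2.unique h3)
  -- The second derivatives of `k` cancel by symmetry. What remains, `dkᴴ(v) dk(w) - dkᴴ(w) dk(v)`,
  -- equals `-[θ v, θ w]`.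
  have hsymm : fderiv ℝ (fderiv ℝ fun e => toMat (k e)) e v w =
      fderiv ℝ (fderiv ℝ fun e => toMat (k e)) e w v :=
    (hk.contDiffAt.isSymmSndFDerivAt
      (by simpa using WithTop.coe_le_coe.2 (le_top (a := (2 : ℕ∞))))) v w
  have h6 : ∀ M : Mat n, adjL n (toMat (k e)) * (toMat (k e) * M) = M := by
    intro M
    rw [← mul_assoc, adjL_mul_toMat, one_mul]
  rw [key, key, hsymm, ← map_sub, ← skewL_coeL (-⁅maurerCartan k e v, maurerCartan k e w⁆)]
  congr 1
  rw [fderiv_toMat hk, fderiv_toMat hk, adjL_mul, adjL_mul, adjL_coeL, adjL_coeL, map_neg,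
    coeL_lie]
  simp only [mul_assoc, h6, neg_mul]
  abel

end MaurerCartan

/-! ### A potential for the orbit form -/

section KirillovForm

variable {n : ℕ} {E : Type*} [NormedAddCommGroup E] [NormedSpace ℝ E]

/-- The linear functional `B(h, ·)`. -/
def killingL (h : u n) : u n →L[ℝ] ℝ := LinearMap.toContinuousLinearMap (killingForm ℝ (u n) h)

lemma killingL_apply (h X : u n) : killingL h X = killingForm ℝ (u n) h X := rfl

/-- The pullback of the left-invariant `1`-form `B(h, ·)` under a map into the unitary group. -/
def potential (h : u n) (k : E → Matrix.unitaryGroup (Fin n) ℂ) (e : E) : E [⋀^Fin 1]→L[ℝ] ℝ :=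
  ContinuousAlternatingMap.ofSubsingletonLIE (𝕜 := ℝ) (0 : Fin 1)
    ((killingL h).comp (maurerCartan k e))

variable {k : E → Matrix.unitaryGroup (Fin n) ℂ} (hk : ContDiff ℝ ∞ fun e => toMat (k e))

include hk

lemma contDiff_potential (h : u n) : ContDiff ℝ ∞ (potential h k) :=
  (ContinuousAlternatingMap.ofSubsingletonLIE (𝕜 := ℝ) (E := E) (F := ℝ)
    (0 : Fin 1)).toContinuousLinearEquiv.contDiff.comp
    (contDiff_const.clm_comp (contDiff_maurerCartan hk))

/-- This is `B(h, ·)` applied to the Maurer–Cartan equation; it exhibits `B(h, [θ, θ])` as an exact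
form. -/
lemma extDeriv_potential_apply (h : u n) (e v w : E) : extDeriv (potential h k) e ![v, w] =
    -killingForm ℝ (u n) h ⁅maurerCartan k e v, maurerCartan k e w⁆ := by
  have key : ∀ (a b : E), fderiv ℝ (fun e => killingL h (maurerCartan k e a)) e b =
      killingL h (fderiv ℝ (maurerCartan k) e b a) := by
    intro a b
    have h1 := ((contDiff_maurerCartan hk).differentiable (by simp) e).hasFDerivAt
    have h2 := (killingL h).hasFDerivAt.comp e
      ((ContinuousLinearMap.apply ℝ (u n) a).hasFDerivAt.comp e h1)
    exact congrArg (fun T => T b) h2.fderiv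
  rw [extDeriv_apply ((contDiff_potential hk h).differentiable (by simp) e), Fin.sum_univ_two]
  have h3 := key w v
  have h4 := key v w
  have h5 := congrArg (killingL h) (fderiv_maurerCartan hk e v w)
  rw [map_sub, map_neg, ← h3, ← h4] at h5
  rw [← killingL_apply, ← h5]
  simp [sub_eq_add_neg]
  rfl

lemma contDiff_extDeriv_potential (h : u n) : ContDiff ℝ ∞ (extDeriv (potential h k)) :=
  (ContinuousAlternatingMap.alternatizeUncurryFinCLM ℝ E ℝ).contDiff.comp
    ((contDiff_potential hk h).fderiv_right (by simp))

lemma extDeriv_extDeriv_potential (h : u n) : extDeriv (extDeriv (potential h k)) = 0 :=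
  extDeriv_extDeriv (contDiff_potential hk h)
    (by simpa using WithTop.coe_le_coe.2 (le_top (a := (2 : ℕ∞))))

end KirillovForm

/-! ### Inverse function theorem -/

section InverseFunction

variable {E V : Type*} [NormedAddCommGroup E] [NormedSpace ℝ E] [CompleteSpace E]
  [NormedAddCommGroup V] [NormedSpace ℝ V]

/-- The inverse function theorem: a smooth map with invertible derivative restricts to a
diffeomorphism near the given point, inside any prescribed neighbourhood. -/
lemma exists_openPartialHomeomorph {f : E → V} (hf : ContDiff ℝ ∞ f) {a : E} {f' : E ≃L[ℝ] V}
    (hf' : HasFDerivAt f (f' : E →L[ℝ] V) a) {U : Set E} (hU : IsOpen U) (ha : a ∈ U) :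
    ∃ e : OpenPartialHomeomorph E V, (e : E → V) = f ∧ a ∈ e.source ∧ e.source ⊆ U ∧
      ContDiffOn ℝ ∞ e.symm e.target := by
  -- Shrinking to points where the derivative stays invertible makes the inverse smooth on the whole
  -- target, not just at `f a`.
  set W : Set E := U ∩ fderiv ℝ f ⁻¹' Set.range ((↑) : (E ≃L[ℝ] V) → E →L[ℝ] V)
  have hW : IsOpen W := hU.inter
    (ContinuousLinearEquiv.isOpen.preimage (hf.continuous_fderiv (by simp)))
  have haW : a ∈ W := ⟨ha, f', hf'.fderiv.symm⟩
  set e₀ := hf.contDiffAt.toOpenPartialHomeomorph f hf' (by simp)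
  refine ⟨e₀.restrOpen W hW, rfl,
    ⟨hf.contDiffAt.mem_toOpenPartialHomeomorph_source hf' (by simp), haW⟩, fun x hx => hx.2.1, ?_⟩
  intro y hy
  obtain ⟨T, hT⟩ := ((e₀.restrOpen W hW).map_target hy).2.2
  have hd := (hf.differentiable (by simp) ((e₀.restrOpen W hW).symm y)).hasFDerivAt
  rw [← hT] at hd
  exact ((e₀.restrOpen W hW).contDiffAt_symm hy hd hf.contDiffAt).contDiffWithinAt

end InverseFunction

/-! ### The slice chart at `h` -/

section Slice

variable {n : ℕ} (h : u n)

lemma mem_adjointOrbit_self : h ∈ adjointOrbit h := ⟨1, (Ad_one h).symm⟩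

instance instNonemptyOrbit : Nonempty (adjointOrbit h) := ⟨⟨h, mem_adjointOrbit_self h⟩⟩

lemma Ad_mem_adjointOrbit_iff (g : Matrix.unitaryGroup (Fin n) ℂ) (y : u n) :
    Ad g y ∈ adjointOrbit h ↔ y ∈ adjointOrbit h := by
  refine ⟨fun hy => ?_, fun hy => Ad_mem_adjointOrbit g ⟨y, hy⟩⟩
  have := Ad_mem_adjointOrbit g⁻¹ ⟨_, hy⟩
  rwa [← Ad_mul, inv_mul_cancel, Ad_one] at this

/-- The adjoint action of a unitary matrix as a continuous linear automorphism. -/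
def AdL (g : Matrix.unitaryGroup (Fin n) ℂ) : u n ≃L[ℝ] u n :=
  (AdEquiv g).toLinearEquiv.toContinuousLinearEquiv

lemma AdL_apply (g : Matrix.unitaryGroup (Fin n) ℂ) (X : u n) : AdL g X = Ad g X := rfl

/-- The range of `ad h`, the tangent space of the orbit at `h`. -/
def tangent : Submodule ℝ (u n) := LinearMap.range (LieAlgebra.ad ℝ (u n) h : u n →ₗ[ℝ] u n)

/-- The kernel of `ad h`, a complement of the tangent space of the orbit at `h`. -/
def normal : Submodule ℝ (u n) := LinearMap.ker (LieAlgebra.ad ℝ (u n) h : u n →ₗ[ℝ] u n)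

/-- The model space of the orbit. -/
abbrev Model : Type := EuclideanSpace ℝ (Fin (Module.finrank ℝ (tangent h)))

/-- A linear isomorphism of the model space with the tangent space at `h`. -/
def modelEquiv : Model h ≃ₗ[ℝ] tangent h :=
  LinearEquiv.ofFinrankEq _ _ finrank_euclideanSpace_fin

/-- The model space as a subspace of `𝔲(n)`. -/
def modelEmb : Model h →L[ℝ] u n :=
  LinearMap.toContinuousLinearMap ((tangent h).subtype ∘ₗ (modelEquiv h : Model h →ₗ[ℝ] tangent h))

lemma modelEmb_apply (v : Model h) : modelEmb h v = modelEquiv h v := rfl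

lemma modelEmb_mem (v : Model h) : modelEmb h v ∈ tangent h := (modelEquiv h v).2

lemma exists_modelEmb_eq {X : u n} (hX : X ∈ tangent h) : ∃ v, modelEmb h v = X :=
  ⟨(modelEquiv h).symm ⟨X, hX⟩, by simp [modelEmb_apply]⟩

lemma exists_modelEmb_add (X : u n) : ∃ v : Model h, ∃ Z ∈ normal h, modelEmb h v + Z = X := by
  obtain ⟨Y, Z, hY, hZ, hX⟩ := Submodule.codisjoint_iff_exists_add_eq.1
    (isCompl_range_ker_ad h).codisjoint X
  obtain ⟨v, hv⟩ := exists_modelEmb_eq h hY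
  exact ⟨v, Z, hZ, by rw [hv, hX]⟩

lemma lie_eq_zero_of_mem_normal {Z : u n} (hZ : Z ∈ normal h) : ⁅h, Z⁆ = 0 := hZ

/-- The component of `X` in `ker (ad h)` does not affect `[h, X]`. -/
lemma exists_lie_modelEmb (X : u n) : ∃ v : Model h, ⁅modelEmb h v, h⁆ = ⁅h, X⁆ := by
  obtain ⟨v, Z, hZ, hX⟩ := exists_modelEmb_add h X
  refine ⟨-v, ?_⟩
  rw [← hX, lie_add, lie_eq_zero_of_mem_normal h hZ, map_neg, neg_lie, lie_skew, add_zero]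

/-- The derivative of the slice map: `(v, Z)` goes to `[v, h] + Z`. -/
def splittingAux : (Model h × normal h) →ₗ[ℝ] u n :=
  LinearMap.coprod
    (-(LieAlgebra.ad ℝ (u n) h : u n →ₗ[ℝ] u n) ∘ₗ (modelEmb h : Model h →ₗ[ℝ] u n))
    (normal h).subtype

lemma splittingAux_apply (p : Model h × normal h) :
    splittingAux h p = ⁅modelEmb h p.1, h⁆ + p.2 := by
  rw [← lie_skew]
  rfl

/-- As range and kernel of `ad h` are complementary, `ad h` maps its range bijectively onto itself.
-/
lemma splittingAux_bijective : Function.Bijective (splittingAux h) := by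
  have hc := isCompl_range_ker_ad h
  constructor
  · rw [injective_iff_map_eq_zero]
    rintro ⟨v, Z⟩ hp
    rw [splittingAux_apply] at hp
    have h1 : (Z : u n) = ⁅h, modelEmb h v⁆ := by
      rw [← lie_skew, eq_neg_iff_add_eq_zero, add_comm]
      exact hp
    have h2 : (Z : u n) = 0 := Submodule.disjoint_def.1 hc.disjoint _ ⟨_, h1.symm⟩ Z.2
    have h3 : modelEmb h v = 0 := Submodule.disjoint_def.1 hc.disjoint _ (modelEmb_mem h v)
      (h1.symm.trans h2)
    refine Prod.ext ?_ (Subtype.ext h2)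
    exact (modelEquiv h).map_eq_zero_iff.1 (Subtype.ext h3)
  · intro Y
    obtain ⟨T, Z, ⟨X, rfl⟩, hZ, hY⟩ := Submodule.codisjoint_iff_exists_add_eq.1 hc.codisjoint Y
    obtain ⟨v, hv⟩ := exists_lie_modelEmb h X
    exact ⟨(v, ⟨Z, hZ⟩), by rw [splittingAux_apply, hv, ← hY]; rfl⟩

/-- The splitting of `𝔲(n)` as the sum of the tangent space and the normal space of the orbit at
`h`. -/
def splitting : (Model h × normal h) ≃L[ℝ] u n :=
  (LinearEquiv.ofBijective (splittingAux h) (splittingAux_bijective h)).toContinuousLinearEquiv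

lemma splitting_apply (p : Model h × normal h) :
    splitting h p = ⁅modelEmb h p.1, h⁆ + p.2 := splittingAux_apply h p

/-- The local parametrization of the unitary group transverse to the stabilizer of `h`. -/
def expSection (v : Model h) : Matrix.unitaryGroup (Fin n) ℂ := expU (modelEmb h v)

lemma contDiff_expSection : ContDiff ℝ ∞ fun v => toMat (expSection h v) :=
  contDiff_toMat_expU.comp (modelEmb h).contDiff

/-- The map `(v, Z) ↦ Ad(exp v) (h + Z)`. -/
def sliceMap (p : Model h × normal h) : u n := Ad (expSection h p.1) (h + p.2)

lemma sliceMap_zero_right (v : Model h) : sliceMap h (v, 0) = Ad (expSection h v) h := by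
  simp [sliceMap]

lemma expSection_zero : expSection h 0 = 1 := by rw [expSection, map_zero, expU_zero]

lemma contDiff_sliceMap : ContDiff ℝ ∞ (sliceMap h) := by
  have h1 : ContDiff ℝ ∞ fun p : Model h × normal h => toMat (expSection h p.1) :=
    (contDiff_expSection h).comp contDiff_fst
  have h2 : ContDiff ℝ ∞ fun p : Model h × normal h => coeL n (h + p.2) :=
    (coeL n).contDiff.comp (contDiff_const.add ((normal h).subtypeL.contDiff.comp contDiff_snd))
  have h3 := (skewL n).contDiff.comp ((h1.mul h2).mul ((adjL n).contDiff.comp h1))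
  rw [show sliceMap h = _ from funext fun p => Ad_eq_skewL _ _]
  exact h3

lemma hasFDerivAt_sliceMap_zero :
    HasFDerivAt (sliceMap h) (splitting h : (Model h × normal h) →L[ℝ] u n) 0 := by
  have h0 : HasFDerivAt (fun v : Model h => toMat (expSection h v))
      ((coeL n).comp (modelEmb h)) 0 := by
    have h1 : HasFDerivAt (fun X : u n => toMat (expU X)) (coeL n) (modelEmb h 0) := by
      rw [map_zero]
      exact hasFDerivAt_toMat_expU_zero
    exact h1.comp 0 (modelEmb h).hasFDerivAt
  have h1 : HasFDerivAt (fun p : Model h × normal h => toMat (expSection h p.1)) _ 0 :=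
    HasFDerivAt.comp (f := Prod.fst) (0 : Model h × normal h) h0 hasFDerivAt_fst
  have h2 : HasFDerivAt (fun p : Model h × normal h => coeL n (h + p.2)) _ 0 :=
    (coeL n).hasFDerivAt.comp (0 : Model h × normal h)
      (((normal h).subtypeL.hasFDerivAt.comp (0 : Model h × normal h) hasFDerivAt_snd).const_add h)
  have h3 := (skewL n).hasFDerivAt.comp (0 : Model h × normal h)
    ((h1.mul' h2).mul' ((adjL n).hasFDerivAt.comp (0 : Model h × normal h) h1))
  refine (h3.congr_of_eventuallyEq (f₁ := sliceMap h)
    (.of_forall fun p => Ad_eq_skewL _ _)).congr_fderiv ?_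
  refine ContinuousLinearMap.ext fun p => ?_
  have h5 : toMat (expSection h 0) = 1 := by rw [expSection_zero]; rfl
  have h6 : adjL n 1 = 1 := Matrix.conjTranspose_one
  -- Product rule at `k = 1`, where `dk = v` and `dkᴴ = -v`: the sum is `v h - h v + Z`.
  change skewL n (toMat (expSection h 0) * coeL n (h + 0) * adjL n (coeL n (modelEmb h p.1)) +
    (toMat (expSection h 0) * coeL n p.2 + coeL n (modelEmb h p.1) * coeL n (h + 0)) *
      adjL n (toMat (expSection h 0))) = splitting h p
  rw [splitting_apply, ← skewL_coeL (⁅modelEmb h p.1, h⁆ + (p.2 : u n)), add_zero,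
    map_add (coeL n), coeL_lie, adjL_coeL, h5, h6]
  congr 1
  simp only [one_mul, mul_one, mul_neg]
  abel

/-- The chart is the local inverse of `sliceMap`. `Ad` preserves the orbit, so only `h + Z` has to
be tested, and the source keeps `Z` in the neighbourhood where membership forces `Z = 0`. -/
lemma exists_slice : ∃ S : Slice (Model h) (normal h) (adjointOrbit h), h ∈ S.chart.source ∧
    S.chart h = 0 ∧ ∀ v, S.chart.symm (v, 0) = Ad (expSection h v) h := by
  obtain ⟨U, hU, h0, hUZ⟩ := exists_nhds_eq_zero_of_add_mem_adjointOrbit h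
  obtain ⟨e, he, hae, heU, hes⟩ := exists_openPartialHomeomorph (contDiff_sliceMap h)
    (hasFDerivAt_sliceMap_zero h) (U := {p | (p.2 : u n) ∈ U})
    (hU.preimage (continuous_subtype_val.comp continuous_snd)) h0
  have h1 : e 0 = h := by
    rw [he]
    change sliceMap h (0, 0) = h
    rw [sliceMap_zero_right, expSection_zero, Ad_one]
  refine ⟨⟨e.symm, hes, ?_, ?_⟩, ?_, ?_, fun v => ?_⟩
  · rw [OpenPartialHomeomorph.symm_symm, he]
    exact (contDiff_sliceMap h).contDiffOn
  · intro y hy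
    have h2 : (e.symm y) ∈ e.source := e.map_target hy
    have h3 : sliceMap h (e.symm y) = y := by rw [← he]; exact e.right_inv hy
    rw [← h3, sliceMap, Ad_mem_adjointOrbit_iff, ← sliceMap, h3]
    constructor
    · intro h4
      exact Subtype.ext (hUZ _ (heU h2) (e.symm y).2.2 h4)
    · intro h4
      rw [h4]
      simpa using mem_adjointOrbit_self h
  · exact h1.subst (motive := fun y => y ∈ e.target) (e.map_source hae)
  · exact h1.subst (motive := fun y => e.symm y = 0) (e.left_inv hae)
  · change e (v, 0) = _
    rw [he, sliceMap_zero_right]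

end Slice

/-! ### Alternating forms evaluated on pairs -/

section TwoForms

variable {E F : Type*} [NormedAddCommGroup E] [NormedSpace ℝ E] [NormedAddCommGroup F]
  [NormedSpace ℝ F]

lemma twoForm_ext {α β : E [⋀^Fin 2]→L[ℝ] ℝ} (H : ∀ v w, α ![v, w] = β ![v, w]) : α = β := by
  refine ContinuousAlternatingMap.ext fun v => ?_
  have h1 : v = ![v 0, v 1] := by
    ext i : 1
    fin_cases i <;> rfl
  rw [h1, H]

lemma compContinuousLinearMap_pair (α : F [⋀^Fin 2]→L[ℝ] ℝ) (f : E →L[ℝ] F) (v w : E) :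
    α.compContinuousLinearMap f ![v, w] = α ![f v, f w] := by
  rw [ContinuousAlternatingMap.compContinuousLinearMap_apply]
  congr 1
  ext i : 1
  fin_cases i <;> rfl

end TwoForms

/-! ### The orbit as a symplectic manifold -/

section OrbitManifold

variable {n : ℕ} {h : u n}

lemma hasFDerivAt_Ad_expSection_zero : HasFDerivAt (fun v => Ad (expSection h v) h)
    ((splitting h : (Model h × normal h) →L[ℝ] u n).comp (.inl ℝ _ _)) 0 := by
  have h1 := (hasFDerivAt_sliceMap_zero h).comp (0 : Model h)
    (ContinuousLinearMap.inl ℝ (Model h) (normal h)).hasFDerivAt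
  exact h1.congr_of_eventuallyEq (.of_forall fun v => (sliceMap_zero_right h v).symm)

lemma lie_maurerCartan_zero (v : Model h) :
    ⁅maurerCartan (expSection h) 0 v, h⁆ = splitting h (v, 0) := by
  have h1 := fderiv_Ad (contDiff_expSection h) h 0 v
  rw [(hasFDerivAt_Ad_expSection_zero (h := h)).fderiv, expSection_zero, Ad_one] at h1
  exact h1.symm

/-- A unitary matrix that moves `h` to the given point of its orbit. -/
def mover (x : adjointOrbit h) : Matrix.unitaryGroup (Fin n) ℂ := x.2.choose

lemma Ad_mover (x : adjointOrbit h) : Ad (mover x) h = x := x.2.choose_spec.symm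

lemma AdL_mem_adjointOrbit_iff (g : Matrix.unitaryGroup (Fin n) ℂ) (y : u n) :
    AdL g y ∈ adjointOrbit h ↔ y ∈ adjointOrbit h := Ad_mem_adjointOrbit_iff h g y

/-- The slice chart of the orbit around a point. -/
def orbitSlice (x : adjointOrbit h) : Slice (Model h) (normal h) (adjointOrbit h) :=
  (exists_slice h).choose.translate (AdL (mover x)) (AdL_mem_adjointOrbit_iff (mover x))

lemma AdL_mover_symm (x : adjointOrbit h) : (AdL (mover x)).symm x = h :=
  (AdL (mover x)).symm_apply_eq.2 (Ad_mover x).symm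

lemma mem_orbitSlice_source (x : adjointOrbit h) : (x : u n) ∈ (orbitSlice x).chart.source := by
  rw [orbitSlice, Slice.mem_translate_source, AdL_mover_symm]
  exact (exists_slice h).choose_spec.1

lemma orbitSlice_restr_self (x : adjointOrbit h) : (orbitSlice x).restr x = 0 := by
  rw [Slice.restr_apply, orbitSlice, Slice.translate_chart_apply, AdL_mover_symm,
    (exists_slice h).choose_spec.2.1]
  rfl

lemma orbitSlice_chart_symm (x : adjointOrbit h) (v : Model h) :
    (orbitSlice x).chart.symm (v, 0) = AdL (mover x) (Ad (expSection h v) h) := by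
  rw [orbitSlice, Slice.translate_chart_symm_apply, (exists_slice h).choose_spec.2.2]

variable (h) in
/-- The manifold structure of an adjoint orbit. -/
@[reducible]
def orbitChartedSpace : ChartedSpace (Model h) (adjointOrbit h) :=
  Slice.chartedSpace orbitSlice mem_orbitSlice_source

attribute [local instance] orbitChartedSpace

lemma isManifold_orbit : IsManifold 𝓘(ℝ, Model h) ∞ (adjointOrbit h) :=
  Slice.isManifold orbitSlice mem_orbitSlice_source

lemma isSmoothEmbedding_orbit : Manifold.IsSmoothEmbedding 𝓘(ℝ, Model h) 𝓘(ℝ, u n) ∞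
    (Subtype.val : adjointOrbit h → u n) :=
  Slice.isSmoothEmbedding orbitSlice mem_orbitSlice_source (splitting h)

lemma fderiv_orbitSlice (x : adjointOrbit h) (e : Model h) :
    fderiv ℝ (fun v => (orbitSlice x).chart.symm (v, 0)) e =
      (AdL (mover x) : u n →L[ℝ] u n).comp (fderiv ℝ (fun v => Ad (expSection h v) h) e) := by
  rw [funext (orbitSlice_chart_symm x)]
  exact (AdL (mover x)).comp_fderiv

/-- The point `x` is the origin of its preferred chart, so only the derivative of the
parametrization at `0` enters. -/
lemma inclDeriv_apply (x : adjointOrbit h) (v : Model h) :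
    inclDeriv (Model h) x v = Ad (mover x) (splitting h (v, 0)) := by
  have h1 := Slice.mfderiv_val orbitSlice mem_orbitSlice_source (splitting h) x
  rw [orbitSlice_restr_self, fderiv_orbitSlice,
    (hasFDerivAt_Ad_expSection_zero (h := h)).fderiv] at h1
  exact congrArg (fun T => T v) h1

/-- Puts the coordinate vectors at any point of a chart into the shape `Ad g [a, h]` that
`IsOrbitForm.apply_eq` evaluates. -/
lemma inclDeriv_mfderiv_symm (x : adjointOrbit h) {e : Model h}
    (he : e ∈ (orbitSlice x).restr.target) (v : Model h) :
    inclDeriv (Model h) ((orbitSlice x).restr.symm e)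
      (mfderiv 𝓘(ℝ, Model h) 𝓘(ℝ, Model h) (orbitSlice x).restr.symm e v) =
      Ad (mover x * expSection h e) ⁅maurerCartan (expSection h) e v, h⁆ := by
  have h1 := Slice.mfderiv_val_mfderiv_symm orbitSlice mem_orbitSlice_source (splitting h) x he v
  rw [fderiv_orbitSlice] at h1
  rw [Ad_mul, ← fderiv_Ad (contDiff_expSection h) h e v]
  exact h1

lemma inclDeriv_injective (x : adjointOrbit h) {v : Model h}
    (hv : inclDeriv (Model h) x v = 0) : v = 0 := by
  rw [inclDeriv_apply, ← AdL_apply, map_eq_zero_iff _ (AdL (mover x)).injective,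
    map_eq_zero_iff _ (splitting h).injective] at hv
  exact congrArg Prod.fst hv

lemma range_inclDeriv (x : adjointOrbit h) :
    Set.range (inclDeriv (Model h) x) = {v | ∃ X : u n, v = ⁅(x : u n), X⁆} := by
  have h1 : ∀ a, Ad (mover x) ⁅h, a⁆ = ⁅(x : u n), Ad (mover x) a⁆ := fun a => by
    rw [Ad_lie, Ad_mover]
  ext y
  constructor
  · rintro ⟨v, rfl⟩
    refine ⟨Ad (mover x) (-modelEmb h v), ?_⟩
    rw [← h1, lie_neg, lie_skew]
    refine (inclDeriv_apply x v).trans ?_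
    rw [splitting_apply]
    simp
  · rintro ⟨X, rfl⟩
    obtain ⟨v, hv⟩ := exists_lie_modelEmb h (Ad (mover x)⁻¹ X)
    refine ⟨v, (inclDeriv_apply x v).trans ?_⟩
    rw [splitting_apply, hv]
    simp only [ZeroMemClass.coe_zero, add_zero]
    rw [h1, ← Ad_mul, mul_inv_cancel, Ad_one]

/-- Well-definedness of the form: `B(x, [X, Y]) = B([x, X], Y)` depends on `X` only through `[x,
X]`, and likewise for `Y` by antisymmetry. -/
lemma killingForm_lie_congr {x X X' Y Y' : u n} (hX : ⁅x, X⁆ = ⁅x, X'⁆) (hY : ⁅x, Y⁆ = ⁅x, Y'⁆) :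
    killingForm ℝ (u n) x ⁅X, Y⁆ = killingForm ℝ (u n) x ⁅X', Y'⁆ := by
  rw [← killingForm_lie_apply, hX, killingForm_lie_apply, ← lie_skew, map_neg,
    ← killingForm_lie_apply, hY, killingForm_lie_apply, ← map_neg, lie_skew]

lemma killingForm_Ad (g : Matrix.unitaryGroup (Fin n) ℂ) (X Y : u n) :
    killingForm ℝ (u n) (Ad g X) (Ad g Y) = killingForm ℝ (u n) X Y :=
  LieAlgebra.killingForm_of_equiv_apply (AdEquiv g) X Y

variable (h) in
/-- The Kirillov–Kostant–Souriau form. In the trivialization of the tangent bundle given by the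
preferred charts it is constant. -/
def orbitForm : TwoFormField (Model h) (adjointOrbit h) := fun _ =>
  -- The sign cancels the one in the Maurer–Cartan equation.
  (-extDeriv (potential h (expSection h)) 0 : Model h [⋀^Fin 2]→L[ℝ] ℝ)

lemma isOrbitForm_orbitForm : IsOrbitForm (orbitForm h) := by
  intro x X Y v w hv hw
  have key : ∀ (X : u n) (v : Model h), inclDeriv (Model h) x v = ⁅(x : u n), X⁆ →
      ⁅(x : u n), X⁆ = ⁅(x : u n), Ad (mover x) (-maurerCartan (expSection h) 0 v)⁆ := by
    intro X v hv
    rw [← hv, inclDeriv_apply, ← lie_maurerCartan_zero, Ad_lie, ← Ad_mover x, ← Ad_lie, ← Ad_lie,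
      lie_neg, lie_skew]
  rw [killingForm_lie_congr (key X v hv) (key Y w hw), ← Ad_lie]
  conv_rhs => rw [← Ad_mover x]
  rw [killingForm_Ad, neg_lie, lie_neg, neg_neg]
  have h1 := extDeriv_potential_apply (contDiff_expSection h) h 0 v w
  change -(extDeriv (potential h (expSection h)) 0 ![v, w]) = _
  rw [h1, neg_neg]

/-- Since `Ad g [a, h] = [x, Ad g (-a)]`, invariance of the Killing form moves the evaluation from
`x` back to `h`. -/
lemma IsOrbitForm.apply_eq {Ω : TwoFormField (Model h) (adjointOrbit h)} (hΩ : IsOrbitForm Ω)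
    {x : adjointOrbit h} {g : Matrix.unitaryGroup (Fin n) ℂ} (hx : (x : u n) = Ad g h) {a b : u n}
    {v w : Model h} (hv : inclDeriv (Model h) x v = Ad g ⁅a, h⁆)
    (hw : inclDeriv (Model h) x w = Ad g ⁅b, h⁆) :
    Ω x ![v, w] = killingForm ℝ (u n) h ⁅a, b⁆ := by
  rw [hΩ x (Ad g (-a)) (Ad g (-b)) v w, hx, ← Ad_lie, killingForm_Ad, neg_lie, lie_neg, neg_neg]
  · rw [hv, hx, ← Ad_lie, lie_neg, lie_skew]
  · rw [hw, hx, ← Ad_lie, lie_neg, lie_skew]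

lemma exists_inclDeriv_eq_lie (x : adjointOrbit h) (v : Model h) :
    ∃ X, inclDeriv (Model h) x v = ⁅(x : u n), X⁆ :=
  (range_inclDeriv x).subset (Set.mem_range_self v)

lemma IsOrbitForm.unique {Ω Ω' : TwoFormField (Model h) (adjointOrbit h)} (hΩ : IsOrbitForm Ω)
    (hΩ' : IsOrbitForm Ω') : Ω' = Ω := by
  funext x
  refine twoForm_ext (E := Model h) fun v w => ?_
  obtain ⟨X, hX⟩ := exists_inclDeriv_eq_lie x v
  obtain ⟨Y, hY⟩ := exists_inclDeriv_eq_lie x w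
  exact (hΩ' x X Y v w hX hY).trans (hΩ x X Y v w hX hY).symm

/-- The translation by `mover x` drops out by invariance, so all charts show the same exact form. -/
lemma inChart_eq {Ω : TwoFormField (Model h) (adjointOrbit h)} (hΩ : IsOrbitForm Ω)
    (x : adjointOrbit h) {e : Model h} (he : e ∈ (orbitSlice x).restr.target) :
    Ω.inChart (orbitSlice x).restr e = -extDeriv (potential h (expSection h)) e := by
  refine twoForm_ext fun v w => ?_
  have h2 : (((orbitSlice x).restr.symm e : adjointOrbit h) : u n) =
      Ad (mover x * expSection h e) h := by
    rw [Slice.coe_restr_symm _ he, orbitSlice_chart_symm, Ad_mul, AdL_apply]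
  have h3 := hΩ.apply_eq h2 (inclDeriv_mfderiv_symm x he v) (inclDeriv_mfderiv_symm x he w)
  have h4 := extDeriv_potential_apply (contDiff_expSection h) h e v w
  rw [ContinuousAlternatingMap.neg_apply, h4, neg_neg, ← h3]
  exact compContinuousLinearMap_pair (E := Model h) (F := Model h) _ _ v w

lemma IsOrbitForm.isSymplectic {Ω : TwoFormField (Model h) (adjointOrbit h)} (hΩ : IsOrbitForm Ω) :
    IsSymplectic Ω where
  smooth := by
    rintro _ ⟨x, rfl⟩
    exact (contDiff_extDeriv_potential (contDiff_expSection h) h).neg.contDiffOn.congr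
      fun e he => inChart_eq hΩ x he
  closed := by
    rintro _ ⟨x, rfl⟩ e he
    have h1 : Ω.inChart (orbitSlice x).restr =ᶠ[nhds e]
        (-1 : ℝ) • extDeriv (potential h (expSection h)) := by
      filter_upwards [(orbitSlice x).restr.open_target.mem_nhds he] with e' he'
      rw [inChart_eq hΩ x he', Pi.smul_apply, neg_one_smul]
    rw [h1.extDeriv_eq, extDeriv_smul, extDeriv_extDeriv_potential (contDiff_expSection h)]
    simp
  nondegenerate := by
    intro x v hv
    obtain ⟨X, hX⟩ := exists_inclDeriv_eq_lie x v
    refine inclDeriv_injective x (hX.trans (lie_eq_zero_of_killingForm fun Y => ?_))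
    -- Every `[x, Y]` is tangent, so the vanishing of `Ω x ![v, ·]` can be tested against any `Y`.
    obtain ⟨w, hw⟩ := (range_inclDeriv x).superset ⟨Y, rfl⟩
    rw [killingForm_lie_apply, ← hΩ x X Y v w hX hw, hv]

/-- The action is the restriction of a linear map, and smoothness into the orbit can be tested after
the embedding. -/
lemma contMDiff_orbitAct (g : Matrix.unitaryGroup (Fin n) ℂ) :
    ContMDiff 𝓘(ℝ, Model h) 𝓘(ℝ, Model h) ∞ (orbitAct g : adjointOrbit h → adjointOrbit h) := by
  have := isManifold_orbit (h := h)
  have h1 : ContMDiff 𝓘(ℝ, Model h) 𝓘(ℝ, u n) ∞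
      (Subtype.val ∘ (orbitAct g : adjointOrbit h → adjointOrbit h)) :=
    (AdL g).contDiff.contMDiff.comp isSmoothEmbedding_orbit.contMDiff
  rw [ContMDiff.iff_comp_isImmersion isSmoothEmbedding_orbit.isImmersion]
  exact ⟨Topology.IsEmbedding.subtypeVal.continuous_iff.2 h1.continuous, h1⟩

lemma inclDeriv_mfderiv_orbitAct (g : Matrix.unitaryGroup (Fin n) ℂ) (x : adjointOrbit h)
    (v : Model h) : inclDeriv (Model h) (orbitAct g x)
      (mfderiv 𝓘(ℝ, Model h) 𝓘(ℝ, Model h) (orbitAct g) x v) =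
      Ad g (inclDeriv (Model h) x v) := by
  have hi : ∀ y : adjointOrbit h, MDifferentiableAt 𝓘(ℝ, Model h) 𝓘(ℝ, u n)
      (Subtype.val : adjointOrbit h → u n) y := fun y =>
    (isSmoothEmbedding_orbit.contMDiff y).mdifferentiableAt (by simp)
  have h1 := mfderiv_comp x (hi (orbitAct g x))
    ((contMDiff_orbitAct g x).mdifferentiableAt (by simp))
  have h2 := mfderiv_comp x (AdL g).differentiableAt.mdifferentiableAt (hi x)
  rw [mfderiv_eq_fderiv, (AdL g).fderiv] at h2
  exact congrArg (fun T => T v) (h1.symm.trans h2)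

/-- The action sends the tangent vector `[x, X]` to `[Ad g x, Ad g X]`, and `Ad g` preserves the
bracket and the Killing form. -/
lemma IsOrbitForm.isInvariant {Ω : TwoFormField (Model h) (adjointOrbit h)} (hΩ : IsOrbitForm Ω) :
    IsInvariant Ω := by
  intro g
  refine ⟨contMDiff_orbitAct g, fun x => twoForm_ext (E := Model h) fun v w => ?_⟩
  obtain ⟨X, hX⟩ := exists_inclDeriv_eq_lie x v
  obtain ⟨Y, hY⟩ := exists_inclDeriv_eq_lie x w
  have h2 : ∀ (X : u n) (v : Model h), inclDeriv (Model h) x v = ⁅(x : u n), X⁆ →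
      inclDeriv (Model h) (orbitAct g x)
        (mfderiv 𝓘(ℝ, Model h) 𝓘(ℝ, Model h) (orbitAct g) x v) =
        ⁅((orbitAct g x : adjointOrbit h) : u n), Ad g X⁆ := by
    intro X v hX
    rw [inclDeriv_mfderiv_orbitAct, hX, Ad_lie]
    rfl
  have h3 := hΩ (orbitAct g x) _ _ _ _ (h2 X v hX) (h2 Y w hY)
  rw [← Ad_lie] at h3
  exact (compContinuousLinearMap_pair (E := Model h) (F := Model h) _ _ v w).trans
    (h3.trans ((killingForm_Ad g _ _).trans (hΩ x X Y v w hX hY).symm))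

end OrbitManifold

end UnitaryOrbit

end

theorem mainTheorem3 (n : ℕ) (h : UnitaryOrbit.u n) :
    ∃ (d : ℕ) (_ : ChartedSpace (EuclideanSpace ℝ (Fin d)) (UnitaryOrbit.adjointOrbit h)),
      IsManifold 𝓘(ℝ, EuclideanSpace ℝ (Fin d)) ∞ (UnitaryOrbit.adjointOrbit h) ∧
      Manifold.IsSmoothEmbedding 𝓘(ℝ, EuclideanSpace ℝ (Fin d)) 𝓘(ℝ, UnitaryOrbit.u n) ∞
        (Subtype.val : UnitaryOrbit.adjointOrbit h → UnitaryOrbit.u n) ∧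
      (∀ x : UnitaryOrbit.adjointOrbit h,
        Set.range (UnitaryOrbit.inclDeriv (EuclideanSpace ℝ (Fin d)) x) =
          {v | ∃ X : UnitaryOrbit.u n, v = ⁅(x : UnitaryOrbit.u n), X⁆}) ∧
      ∃ Ω : UnitaryOrbit.TwoFormField (EuclideanSpace ℝ (Fin d)) (UnitaryOrbit.adjointOrbit h),
        UnitaryOrbit.IsOrbitForm Ω ∧
        (∀ Ω' : UnitaryOrbit.TwoFormField (EuclideanSpace ℝ (Fin d))
          (UnitaryOrbit.adjointOrbit h), UnitaryOrbit.IsOrbitForm Ω' → Ω' = Ω) ∧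
        UnitaryOrbit.IsInvariant Ω ∧
        UnitaryOrbit.IsSymplectic Ω :=
  ⟨_, UnitaryOrbit.orbitChartedSpace h, UnitaryOrbit.isManifold_orbit,
    UnitaryOrbit.isSmoothEmbedding_orbit, UnitaryOrbit.range_inclDeriv, UnitaryOrbit.orbitForm h,
    UnitaryOrbit.isOrbitForm_orbitForm, fun _ hΩ' => UnitaryOrbit.isOrbitForm_orbitForm.unique hΩ',
    UnitaryOrbit.isOrbitForm_orbitForm.isInvariant,
    UnitaryOrbit.isOrbitForm_orbitForm.isSymplectic⟩
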